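/- Let $M$ be a matroid of rank $k$ on a finite ground set $E$ with $|E|=n$ and $k<n$, let $\mathbb{L}$ be a field and $S=\mathbb{L}[x_e : e\in E]$ with the standard grading. Let $\Delta(M)$ be the independence complex of $M$ and let $I=I_{\Delta(M)}\subset S$ be its Stanley--Reisner ideal, generated by the monomials $\prod_{e\in U}x_e$ with $U\subseteq E$ dependent in $M$. For $s\ge 0$ let $I^{(s)}=\bigcap_{P\in\mathrm{Ass}(S/I)}(I^sS_P\cap S)$ be the $s$-th symbolic power of $I$, let $\alpha(I^{(s)})$ be the least degree of a nonzero homogeneous element of $I^{(s)}$, and let $\widehat\alpha(I)=\lim_{s\to\infty}\alpha(I^{(s)})/s$ be the Waldschmidt constant of $I$. For $1\le r\le n-k$ let the $r$-th generalized Hamming weight $d_r(M)$ be the minimum size of a circuit of the matroid on $E$ whose independent sets are the sets $A\subseteq E$ with $|A|-\mathrm{rk}_M(A)\le r-1$ (the elongation of $M$ by rank $r-1$), and put $d_0(M)=0$. Then the following two conditions are equivalent: (1) $\alpha(I^{(s)})=q\,d_{n-k}(M)+d_r(M)$ for all integers $s=(n-k)q+r$ with $q\ge 0$ and $0\le r<n-k$;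 (2) the sequence $\{d_i(M)\}_{i=1}^{n-k}$ is extended subadditive, that is, $d_{i+j}(M)\le d_i(M)+d_j(M)$ for all $i,j\ge 1$ with $i+j\le n-k$, and $d_r(M)+d_{n-k}(M)\le d_t(M)+d_{n-k+r-t}(M)$ for all $1\le r<t\le n-k$. Moreover, if these conditions hold, then the limit $\widehat\alpha(I)$ exists and $$\widehat\alpha(I)=\frac{d_{n-k}(M)}{n-k}.$$ -/

import Mathlib

noncomputable section

/-! ### Elongation and generalized Hamming weights of a matroid -/

/-- The elongation of a finite matroid `M` by rank `r`: the matroid on the ground set of `M` whose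
independent sets are the subsets `A` of nullity `|A| - rk A ≤ r`. -/
def Matroid.elongation {α : Type*} (M : Matroid α) [hM : M.Finite] (r : ℕ) : Matroid α :=
  (IndepMatroid.ofFinite (E := M.E) hM.ground_finite
    (fun A => A ⊆ M.E ∧ A.encard ≤ M.eRk A + (r : ℕ∞))
    (by simp)
    (by
      rintro I J ⟨hJE, hJ⟩ hIJ
      refine ⟨hIJ.trans hJE, ?_⟩
      have hfin : (J \ I).Finite := (hM.ground_finite.subset hJE).subset Set.sdiff_subset
      have h1 : (J \ I).encard + I.encard = J.encard := Set.encard_sdiff_add_encard_of_subset hIJ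
      have h2 : M.eRk J ≤ M.eRk I + (J \ I).encard := by
        have := M.eRk_union_le_eRk_add_encard I (J \ I)
        rwa [Set.union_sdiff_cancel hIJ] at this
      have hne : (J \ I).encard ≠ ⊤ := Set.encard_ne_top_iff.2 hfin
      rw [← ENat.add_le_add_iff_left hne, h1]
      refine hJ.trans ?_
      calc M.eRk J + (r : ℕ∞) ≤ (M.eRk I + (J \ I).encard) + r := by gcongr
        _ = (J \ I).encard + (M.eRk I + r) := by ring)
    (by
      rintro I J ⟨hIE, hI⟩ ⟨hJE, hJ⟩ hlt
      have hIf := hM.ground_finite.subset hIE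
      have hJf := hM.ground_finite.subset hJE
      by_cases hrk : M.eRk I < M.eRk J
      · obtain ⟨e, he, hre⟩ := M.exists_eRk_insert_eq_add_one_of_lt hrk
        have heI : e ∉ I := he.2
        refine ⟨e, he.1, heI, Set.insert_subset (hJE he.1) hIE, ?_⟩
        rw [Set.encard_insert_of_notMem heI, hre]
        calc I.encard + 1 ≤ (M.eRk I + r) + 1 := by gcongr
          _ = M.eRk I + 1 + r := by ring
      · obtain ⟨e, heJ, heI⟩ := Set.exists_mem_notMem_of_ncard_lt_ncard hlt hIf
        refine ⟨e, heJ, heI, Set.insert_subset (hJE heJ) hIE, ?_⟩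
        have hlt' : I.encard + 1 ≤ J.encard := by
          rw [← hIf.cast_ncard_eq, ← hJf.cast_ncard_eq]
          exact_mod_cast hlt
        rw [Set.encard_insert_of_notMem heI]
        calc I.encard + 1 ≤ J.encard := hlt'
          _ ≤ M.eRk J + r := hJ
          _ ≤ M.eRk I + r := by gcongr; exact not_lt.1 hrk
          _ ≤ M.eRk (insert e I) + r := by
            gcongr; exact M.eRk_mono (Set.subset_insert e I))
    (fun _ hI => hI.1)).matroid

/-- The `r`-th generalized Hamming weight of `M` for `1 ≤ r ≤ |E| - rk M`: the minimum size of a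
circuit of the elongation of `M` by rank `r - 1`. By convention, the `0`-th weight is `0`. -/
def Matroid.generalizedHammingWeight {α : Type*} (M : Matroid α) [M.Finite] : ℕ → ℕ
  | 0 => 0
  | r + 1 => sInf {m : ℕ | ∃ C : Set α, (M.elongation r).IsCircuit C ∧ C.ncard = m}

/-! ### Extended subadditive sequences -/

/-- The finite sequence `d 1, …, d D` is subadditive. -/
def IsSubadditiveSeq (d : ℕ → ℕ) (D : ℕ) : Prop :=
  ∀ i j : ℕ, 1 ≤ i → 1 ≤ j → i + j ≤ D → d (i + j) ≤ d i + d j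

/-- The finite sequence `d 1, …, d D` is extended subadditive. The natural-number subtraction is
not truncated, since `r ≤ D + r - t` in the range considered. -/
def IsExtendedSubadditiveSeq (d : ℕ → ℕ) (D : ℕ) : Prop :=
  IsSubadditiveSeq d D ∧
    ∀ r t : ℕ, 1 ≤ r → r < t → t ≤ D → d r + d D ≤ d t + d (D + r - t)

/-! ### Stanley-Reisner ideals -/

/-- The independence complex of `M`. A simplicial complex on a vertex set `σ` (containing the empty
face) is a down-closed family of finite subsets of `σ`. -/
def Matroid.independenceComplex {α : Type*} (M : Matroid α) : LowerSet (Finset M.E) where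
  carrier := {A | M.Indep ((↑) '' (A : Set M.E))}
  lower' := fun _ _ hBA hA => Matroid.Indep.subset hA (Set.image_mono (Finset.coe_subset.2 hBA))

/-- The Stanley-Reisner ideal of a simplicial complex `Δ` on the vertex set `σ`, over `L`: the ideal
generated by the squarefree monomials `x^U` with `U` not a face of `Δ`. -/
def stanleyReisnerIdeal {σ : Type*} (L : Type*) [Field L] (Δ : LowerSet (Finset σ)) :
    Ideal (MvPolynomial σ L) :=
  Ideal.span {p | ∃ U : Finset σ, U ∉ Δ ∧ p = ∏ e ∈ U, MvPolynomial.X e}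

/-! ### Symbolic powers, initial degree, Waldschmidt constant -/

/-- The `s`-th symbolic power of `I`: the intersection, over the associated primes `P` of `R ⧸ I`,
of the contractions to `R` of `I ^ s R_P`. -/
def symbolicPower {R : Type*} [CommRing R] (I : Ideal R) (s : ℕ) : Ideal R :=
  ⨅ P : associatedPrimes R (R ⧸ I),
    haveI : P.1.IsPrime := P.2.1
    ((I ^ s).map (algebraMap R (Localization.AtPrime P.1))).comap
      (algebraMap R (Localization.AtPrime P.1))

/-- The initial degree of a nonzero homogeneous ideal of a polynomial ring: the least `d` such that
the ideal has a nonzero homogeneous element of degree `d`. -/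
def initialDegree {σ L : Type*} [Field L] (I : Ideal (MvPolynomial σ L)) : ℕ :=
  sInf {d : ℕ | ∃ f ∈ I, f ≠ 0 ∧ f.IsHomogeneous d}

/-- The Waldschmidt constant of a homogeneous ideal: the limit of `α(I^(s)) / s`. -/
def waldschmidtConstant {σ L : Type*} [Field L] (I : Ideal (MvPolynomial σ L)) : ℝ :=
  Filter.limUnder Filter.atTop (fun s : ℕ => (initialDegree (symbolicPower I s) : ℝ) / (s : ℝ))

end

/-! Write `P_F = (x_e : e ∉ F)`. Since `I` is squarefree, a monomial `x^m` lies in `I^(s)` iff its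
exponents off each base `F` sum to at least `s` (`symbolicPower_le_weightIdeal`,
`monomial_mem_symbolicPower`). So `α(I^(s))` is the least degree of such an `m`, while `d_r` is the
least size of a set of nullity at least `r`.

Upper bound: the indicator of a set attaining `d_r` has weight at least `r` off every base; adding
`q` copies of the one for `d_D`, `D = n - k`, gives degree `q d_D + d_r` in `I^(qD + r)`.

Lower bound: slice `m` into its level sets `A_j = {e : j < m e}`. For this decreasing chain some
base `B` meets every `A_j` in a basis (`Matroid.exists_isBase_inter_isBasis_of_antitone`), so `a_j =
|A_j \ B|` is the nullity of `A_j` and `|A_j| ≥ d_(a_j)`. Testing `m` on `B` gives `∑ a_j ≥ s`, and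
extended subadditivity bounds `∑ d_(a_j)` below by the formula of (1) at `∑ a_j`.

Conversely, `d_i + d_j` is always a degree occurring in `I^(i+j)`; comparing with (1) yields every
inequality of (2). -/

/-! ### Ideals of a monomial valuation -/

namespace MvPolynomial

variable {σ L : Type*} [Field L]

/-- The polynomials all of whose monomials have weight at least `s`. -/
def weightIdeal (L : Type*) [Field L] (w : σ → ℕ) (s : ℕ) : Ideal (MvPolynomial σ L) where
  carrier := {f | (s : ℕ∞) ≤ (f : MvPowerSeries σ L).weightedOrder w}
  zero_mem' := by simp
  add_mem' {f g} hf hg := by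
    simp only [Set.mem_ofPred_eq, coe_add] at *
    exact (le_min hf hg).trans (MvPowerSeries.min_weightedOrder_le_add w)
  smul_mem' c f hf := by
    simp only [Set.mem_ofPred_eq, smul_eq_mul, coe_mul, MvPowerSeries.weightedOrder_mul] at *
    exact hf.trans le_add_self

theorem mem_weightIdeal {w : σ → ℕ} {s : ℕ} {f : MvPolynomial σ L} :
    f ∈ weightIdeal L w s ↔ (s : ℕ∞) ≤ (f : MvPowerSeries σ L).weightedOrder w := Iff.rfl

theorem mem_weightIdeal_iff_forall_support {w : σ → ℕ} {s : ℕ} {f : MvPolynomial σ L} :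
    f ∈ weightIdeal L w s ↔ ∀ m ∈ f.support, s ≤ Finsupp.weight w m := by
  rw [mem_weightIdeal]
  constructor
  · intro h m hm
    have := h.trans (MvPowerSeries.weightedOrder_le w (d := m) (by simpa using hm))
    exact_mod_cast this
  · intro h
    refine MvPowerSeries.nat_le_weightedOrder w fun d hd => ?_
    by_contra hne
    exact absurd (h d (by simpa using hne)) (not_le.2 hd)

/-- The weighted order is additive on products, so a product of two polynomials of order zero has
order zero. -/
theorem isPrime_weightIdeal_one (w : σ → ℕ) : (weightIdeal L w 1).IsPrime := by
  refine ⟨?_, ?_⟩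
  · rw [Ne, Ideal.eq_top_iff_one, mem_weightIdeal]
    simp
  · intro f g h
    simp only [mem_weightIdeal, coe_mul, MvPowerSeries.weightedOrder_mul, Nat.cast_one,
      Order.one_le_iff_ne_zero] at *
    by_contra! hc
    exact h (by simp [hc.1, hc.2])

theorem weightIdeal_one_pow_le (w : σ → ℕ) (s : ℕ) :
    weightIdeal L w 1 ^ s ≤ weightIdeal L w s := by
  induction s with
  | zero => intro f _; simp [mem_weightIdeal]
  | succ s ih =>
    rw [pow_succ, Ideal.mul_le]
    intro f hf g hg
    rw [mem_weightIdeal, coe_mul, MvPowerSeries.weightedOrder_mul, Nat.cast_add]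
    exact add_le_add (ih hf) hg

theorem mem_weightIdeal_of_mul_mem {w : σ → ℕ} {s : ℕ} {f g : MvPolynomial σ L}
    (hg : g ∉ weightIdeal L w 1) (h : g * f ∈ weightIdeal L w s) : f ∈ weightIdeal L w s := by
  rw [mem_weightIdeal, Nat.cast_one, Order.one_le_iff_ne_zero, not_not] at hg
  rwa [mem_weightIdeal, coe_mul, MvPowerSeries.weightedOrder_mul, hg, zero_add] at h

end MvPolynomial

/-! ### Symbolic powers of a Stanley-Reisner ideal, read off the facets -/

section StanleyReisner

open MvPolynomial

variable {σ L : Type*} [Field L] {Δ : LowerSet (Finset σ)}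

/-- The indicator function of the complement of `F`. -/
def complWeight [DecidableEq σ] (F : Finset σ) (e : σ) : ℕ := if e ∈ F then 0 else 1

theorem one_le_weight_complWeight [DecidableEq σ] {F : Finset σ} {m : σ →₀ ℕ} :
    1 ≤ Finsupp.weight (complWeight F) m ↔ ¬ m.support ⊆ F := by
  rw [Nat.one_le_iff_ne_zero, Finsupp.weight_apply, Finsupp.sum, Ne, Finset.sum_eq_zero_iff,
    not_iff_not]
  refine forall₂_congr fun e he => ?_
  have : m e ≠ 0 := by simpa using he
  simp [complWeight, this]

theorem prod_X_eq_monomial [DecidableEq σ] (U : Finset σ) :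
    (∏ e ∈ U, X e : MvPolynomial σ L) = monomial (Finsupp.indicator U fun _ _ => 1) 1 := by
  rw [monomial_eq, map_one, one_mul, Finsupp.prod_of_support_subset _
    (Finsupp.support_indicator_subset U _) _ (by simp)]
  exact Finset.prod_congr rfl fun e he => by simp [Finsupp.indicator_of_mem he]

theorem support_indicator_one (U : Finset σ) :
    (Finsupp.indicator U fun _ _ => (1 : ℕ)).support = U := by
  ext e
  by_cases he : e ∈ U
  · simp [Finsupp.indicator_of_mem he, he]
  · simp [Finsupp.indicator_of_notMem he, he]

theorem mem_stanleyReisnerIdeal [DecidableEq σ] {f : MvPolynomial σ L} :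
    f ∈ stanleyReisnerIdeal L Δ ↔ ∀ m ∈ f.support, m.support ∉ Δ := by
  have h : stanleyReisnerIdeal L Δ = Ideal.span ((fun m => monomial m (1 : L)) ''
      ((fun U : Finset σ => Finsupp.indicator U fun _ _ => 1) '' {U | U ∉ Δ})) := by
    rw [stanleyReisnerIdeal]
    congr 1
    ext p
    simp [prod_X_eq_monomial, eq_comm]
  rw [h, mem_ideal_span_monomial_image]
  refine forall₂_congr fun m _ => ?_
  simp only [Set.mem_image, Set.mem_ofPred_eq, exists_exists_and_eq_and]
  constructor
  · rintro ⟨U, hU, hUm⟩ hm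
    refine hU (Δ.lower (fun e he => ?_) hm)
    have := hUm e
    rw [Finsupp.indicator_of_mem he] at this
    simp only [Finsupp.mem_support_iff]
    omega
  · intro hm
    refine ⟨_, hm, fun e => ?_⟩
    by_cases he : e ∈ m.support
    · rw [Finsupp.indicator_of_mem he]
      have : m e ≠ 0 := by simpa using he
      omega
    · rw [Finsupp.indicator_of_notMem he]
      exact Nat.zero_le _

theorem stanleyReisnerIdeal_le_weightIdeal [DecidableEq σ] {F : Finset σ} (hF : F ∈ Δ) :
    stanleyReisnerIdeal L Δ ≤ weightIdeal L (complWeight F) 1 := by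
  intro f hf
  rw [mem_weightIdeal_iff_forall_support]
  intro m hm
  rw [one_le_weight_complWeight]
  exact fun h => mem_stanleyReisnerIdeal.1 hf m hm (Δ.lower h hF)

/-- Exhibits `P_F` as the annihilator of the class of `x^F`, hence as an associated prime. -/
theorem mul_prod_X_mem_stanleyReisnerIdeal [DecidableEq σ] {F : Finset σ}
    (hF : Maximal (· ∈ Δ) F) {f : MvPolynomial σ L} :
    f * ∏ e ∈ F, X e ∈ stanleyReisnerIdeal L Δ ↔ f ∈ weightIdeal L (complWeight F) 1 := by
  constructor
  · intro h
    refine ((isPrime_weightIdeal_one _).mem_or_mem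
      (stanleyReisnerIdeal_le_weightIdeal hF.1 h)).resolve_right fun h' => ?_
    rw [prod_X_eq_monomial, mem_weightIdeal_iff_forall_support] at h'
    have := h' (Finsupp.indicator F fun _ _ => 1) (by simp)
    rw [one_le_weight_complWeight, support_indicator_one] at this
    exact this subset_rfl
  · intro h
    rw [mem_weightIdeal_iff_forall_support] at h
    rw [mem_stanleyReisnerIdeal]
    intro m hm hmΔ
    rw [prod_X_eq_monomial, mem_support_iff, coeff_mul_monomial'] at hm
    split_ifs at hm with hle
    · have h1 := h (m - Finsupp.indicator F fun _ _ => 1) (by simpa using hm)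
      rw [one_le_weight_complWeight] at h1
      -- A face containing the facet `F` equals `F`, so dividing by `x^F` leaves a monomial
      -- supported in `F`, of weight zero.
      have hsub : F ⊆ m.support := by
        have := Finsupp.support_mono hle
        rwa [support_indicator_one] at this
      have := hF.2 hmΔ hsub
      exact h1 (Finsupp.support_tsub.trans this)
    · exact hm rfl

theorem mem_colon_bot_singleton_mk {R : Type*} [CommRing R] {I : Ideal R} {x f : R} :
    f ∈ Submodule.colon (⊥ : Submodule R (R ⧸ I)) {Ideal.Quotient.mk I x} ↔ f * x ∈ I := by
  rw [Submodule.mem_colon_singleton, Submodule.mem_bot, ← Ideal.Quotient.eq_zero_iff_mem, map_mul]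
  rfl

variable [Finite σ]

theorem weightIdeal_mem_associatedPrimes [DecidableEq σ] {F : Finset σ}
    (hF : Maximal (· ∈ Δ) F) :
    weightIdeal L (complWeight F) 1 ∈
      associatedPrimes (MvPolynomial σ L) (MvPolynomial σ L ⧸ stanleyReisnerIdeal L Δ) := by
  rw [AssociatedPrimes.mem_iff, isAssociatedPrime_iff]
  refine ⟨isPrime_weightIdeal_one _, Ideal.Quotient.mk _ (∏ e ∈ F, X e), ?_⟩
  ext f
  rw [mem_colon_bot_singleton_mk, mul_prod_X_mem_stanleyReisnerIdeal hF]

/-- If `P` is the annihilator of `h`, some monomial of `h` is supported on a face. For a facet `F`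
containing that face, `h ∉ P_F`, while `P h ⊆ I ⊆ P_F`. Containment, rather than equality, is all
that is needed later. -/
theorem exists_maximal_face_of_mem_associatedPrimes [DecidableEq σ] {P : Ideal (MvPolynomial σ L)}
    (hP : P ∈ associatedPrimes (MvPolynomial σ L) (MvPolynomial σ L ⧸ stanleyReisnerIdeal L Δ)) :
    ∃ F, Maximal (· ∈ Δ) F ∧ P ≤ weightIdeal L (complWeight F) 1 := by
  rw [AssociatedPrimes.mem_iff, isAssociatedPrime_iff] at hP
  obtain ⟨hprime, x, hx⟩ := hP
  obtain ⟨h, rfl⟩ := Ideal.Quotient.mk_surjective x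
  have hmem : ∀ f, f ∈ P ↔ f * h ∈ stanleyReisnerIdeal L Δ := fun f => by
    rw [hx, mem_colon_bot_singleton_mk]
  have hh : h ∉ stanleyReisnerIdeal L Δ := fun hc =>
    hprime.ne_top ((Ideal.eq_top_iff_one P).2 ((hmem 1).2 (by simpa using hc)))
  rw [mem_stanleyReisnerIdeal] at hh
  push Not at hh
  obtain ⟨m, hm, hmΔ⟩ := hh
  obtain ⟨F, hmF, hF⟩ := (Set.toFinite {F | F ∈ Δ}).exists_le_maximal hmΔ
  refine ⟨F, hF, fun f hf => ?_⟩
  refine ((isPrime_weightIdeal_one _).mem_or_mem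
    (stanleyReisnerIdeal_le_weightIdeal hF.1 ((hmem f).1 hf))).resolve_right fun h' => ?_
  exact one_le_weight_complWeight.1 ((mem_weightIdeal_iff_forall_support.1 h') m hm) hmF

theorem symbolicPower_le_weightIdeal [DecidableEq σ] {F : Finset σ} (hF : Maximal (· ∈ Δ) F)
    (s : ℕ) : symbolicPower (stanleyReisnerIdeal L Δ) s ≤ weightIdeal L (complWeight F) s := by
  intro f hf
  have hprime := isPrime_weightIdeal_one (L := L) (complWeight F)
  have hf' := (Ideal.mem_iInf.1 hf) ⟨_, weightIdeal_mem_associatedPrimes hF⟩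
  rw [Ideal.mem_comap, IsLocalization.algebraMap_mem_map_algebraMap_iff
    (weightIdeal L (complWeight F) 1).primeCompl] at hf'
  obtain ⟨g, hg, hgf⟩ := hf'
  exact mem_weightIdeal_of_mul_mem hg (weightIdeal_one_pow_le _ s
    (Ideal.pow_right_mono (stanleyReisnerIdeal_le_weightIdeal hF.1) s hgf))

/-- After localizing at `P ≤ P_F` the monomial `x^F` is a unit, so each `x_e` with `e ∉ F` lies in
the extension of `I`; the hypothesis supplies at least `s` such factors. -/
theorem monomial_mem_symbolicPower [DecidableEq σ] {s : ℕ} {m : σ →₀ ℕ}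
    (hm : ∀ F, Maximal (· ∈ Δ) F → s ≤ Finsupp.weight (complWeight F) m) :
    monomial m (1 : L) ∈ symbolicPower (stanleyReisnerIdeal L Δ) s := by
  have := Fintype.ofFinite σ
  refine Ideal.mem_iInf.2 fun ⟨P, hP⟩ => ?_
  have hprime : P.IsPrime := hP.1
  obtain ⟨F, hF, hPF⟩ := exists_maximal_face_of_mem_associatedPrimes hP
  rw [Ideal.mem_comap, Ideal.map_pow]
  set J := (stanleyReisnerIdeal L Δ).map
    (algebraMap (MvPolynomial σ L) (Localization.AtPrime P)) with hJ
  have hX : ∀ e, algebraMap (MvPolynomial σ L) (Localization.AtPrime P) (X e) ∈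
      J ^ complWeight F e := by
    intro e
    by_cases he : e ∈ F
    · simp [complWeight, he]
    · rw [complWeight, if_neg he, pow_one, hJ,
        IsLocalization.algebraMap_mem_map_algebraMap_iff P.primeCompl]
      refine ⟨∏ e ∈ F, X e, fun hc => ?_, ?_⟩
      · have := mem_weightIdeal_iff_forall_support.1 (hPF hc)
          (Finsupp.indicator F fun _ _ => 1) (by simp [prod_X_eq_monomial])
        rw [one_le_weight_complWeight, support_indicator_one] at this
        exact this subset_rfl
      · rw [mul_comm, mul_prod_X_mem_stanleyReisnerIdeal hF, mem_weightIdeal_iff_forall_support]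
        intro m hm
        rw [support_X, Finset.mem_singleton] at hm
        subst hm
        simp [Finsupp.weight_single, complWeight, he]
  refine Ideal.pow_le_pow_right (hm F hF) ?_
  rw [monomial_eq, map_one, one_mul, Finsupp.prod_fintype _ _ (by simp), map_prod,
    Finsupp.weight_eq_sum, ← Finset.prod_pow_eq_pow_sum]
  refine Ideal.prod_mem_prod fun e _ => ?_
  rw [map_pow, smul_eq_mul, mul_comm, pow_mul]
  exact Ideal.pow_mem_pow (hX e) _

theorem initialDegree_symbolicPower_stanleyReisnerIdeal [DecidableEq σ] (s : ℕ) :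
    initialDegree (symbolicPower (stanleyReisnerIdeal L Δ) s) =
      sInf {d | ∃ m : σ →₀ ℕ, (∀ F, Maximal (· ∈ Δ) F → s ≤ Finsupp.weight (complWeight F) m) ∧
        m.degree = d} := by
  rw [initialDegree]
  congr 1
  ext d
  constructor
  · rintro ⟨f, hf, hf0, hd⟩
    obtain ⟨m, hm⟩ := ne_zero_iff.1 hf0
    refine ⟨m, fun F hF => mem_weightIdeal_iff_forall_support.1
      (symbolicPower_le_weightIdeal hF s hf) m (by simpa using hm), ?_⟩
    rw [Finsupp.degree_eq_weight_one]
    exact hd hm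
  · rintro ⟨m, hm, rfl⟩
    exact ⟨monomial m 1, monomial_mem_symbolicPower hm, by simp, isHomogeneous_monomial _ rfl⟩

end StanleyReisner

/-! ### Hamming weights as minimal sizes at given nullity, and bases adapted to a chain -/

namespace Matroid

variable {α : Type*} {M : Matroid α}

theorem elongation_indep_iff [M.Finite] {r : ℕ} {A : Set α} :
    (M.elongation r).Indep A ↔ A ⊆ M.E ∧ A.encard ≤ M.eRk A + (r : ℕ∞) := Iff.rfl

theorem elongation_ground [M.Finite] (r : ℕ) : (M.elongation r).E = M.E := rfl

theorem generalizedHammingWeight_le [M.Finite] {r : ℕ} {U : Set α} (hU : U ⊆ M.E)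
    (h : M.eRk U + r ≤ U.encard) : M.generalizedHammingWeight r ≤ U.ncard := by
  cases r with
  | zero => exact Nat.zero_le _
  | succ r =>
    have hUfin := M.ground_finite.subset hU
    have hdep : (M.elongation r).Dep U := by
      refine ⟨fun hi => ?_, hU⟩
      have h1 := h.trans (elongation_indep_iff.1 hi).2
      have h2 : M.eRk U ≠ ⊤ :=
        ((M.eRk_le_encard U).trans_lt (Set.encard_lt_top_iff.2 hUfin)).ne
      have h3 := (ENat.add_le_add_iff_left h2).1 h1
      norm_cast at h3
      omega
    obtain ⟨C, hCU, hC⟩ := hdep.exists_isCircuit_subset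
    have hle : M.generalizedHammingWeight (r + 1) ≤ C.ncard := Nat.sInf_le ⟨C, hC, rfl⟩
    exact hle.trans (Set.ncard_le_ncard hCU hUfin)

theorem exists_ncard_eq_generalizedHammingWeight [M.Finite] {r : ℕ}
    (h : M.eRank + r ≤ M.E.encard) :
    ∃ U ⊆ M.E, M.eRk U + r ≤ U.encard ∧ U.ncard = M.generalizedHammingWeight r := by
  cases r with
  | zero => exact ⟨∅, Set.empty_subset _, by simp, by simp [generalizedHammingWeight]⟩
  | succ r =>
    have key : ∀ U ⊆ M.E, (M.elongation r).Dep U ↔ M.eRk U + (r + 1 : ℕ) ≤ U.encard := by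
      intro U hU
      rw [Dep, elongation_indep_iff, elongation_ground]
      simp only [hU, true_and, and_true, not_le, Nat.cast_add, Nat.cast_one, ← add_assoc]
      refine (ENat.add_one_le_iff ?_).symm
      exact WithTop.add_ne_top.2 ⟨((M.eRk_le_encard U).trans_lt
        (Set.encard_lt_top_iff.2 (M.ground_finite.subset hU))).ne, ENat.natCast_ne_top r⟩
    have hdep := (key M.E subset_rfl).2 (by rwa [eRk_ground])
    obtain ⟨C₀, -, hC₀⟩ := hdep.exists_isCircuit_subset
    have hne : {m : ℕ | ∃ C : Set α, (M.elongation r).IsCircuit C ∧ C.ncard = m}.Nonempty :=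
      ⟨_, C₀, hC₀, rfl⟩
    obtain ⟨C, hC, hCr⟩ := Nat.sInf_mem hne
    exact ⟨C, hC.dep.subset_ground, (key C hC.dep.subset_ground).1 hC.dep, hCr⟩

theorem generalizedHammingWeight_mono [M.Finite] {r t : ℕ} (hrt : r ≤ t)
    (h : M.eRank + t ≤ M.E.encard) :
    M.generalizedHammingWeight r ≤ M.generalizedHammingWeight t := by
  obtain ⟨U, hU, hUt, hc⟩ := exists_ncard_eq_generalizedHammingWeight h
  rw [← hc]
  refine generalizedHammingWeight_le hU (le_trans ?_ hUt)
  gcongr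

/-- The basis is grown from the smallest set outwards: a basis adapted to the tail of the chain is
extended to a basis of `U 0`. -/
theorem exists_isBasis_inter_of_antitone (N : ℕ) (U : ℕ → Set α) (hU : Antitone U)
    (hE : U 0 ⊆ M.E) : ∃ I, M.IsBasis I (U 0) ∧ ∀ j < N, M.IsBasis (I ∩ U j) (U j) := by
  induction N generalizing U with
  | zero =>
    obtain ⟨I, hI⟩ := M.exists_isBasis (U 0)
    exact ⟨I, hI, by simp⟩
  | succ N ih =>
    have h10 : U 1 ⊆ U 0 := hU zero_le_one
    obtain ⟨I, hI, hIj⟩ := ih (fun j => U (j + 1)) (fun a b hab => hU (by omega))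
      (h10.trans hE)
    obtain ⟨J, hJ, hIJ⟩ := hI.indep.subset_isBasis_of_subset (hI.subset.trans h10) hE
    refine ⟨J, hJ, fun j hj => ?_⟩
    cases j with
    | zero => rwa [Set.inter_eq_self_of_subset_left hJ.subset]
    | succ j =>
      have hb := hIj j (by omega)
      -- The enlargement adds nothing inside `U (j + 1)`, where the old trace is already a maximal
      -- independent set.
      have := hb.eq_of_subset_indep (hJ.indep.inter_right (U (j + 1)))
        (Set.inter_subset_inter_left _ hIJ) Set.inter_subset_right
      rwa [this] at hb

theorem exists_isBase_inter_isBasis_of_antitone (N : ℕ) (U : ℕ → Set α) (hU : Antitone U)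
    (hE : U 0 ⊆ M.E) : ∃ B, M.IsBase B ∧ ∀ j < N, M.IsBasis (B ∩ U j) (U j) := by
  obtain ⟨I, hI, hIj⟩ := M.exists_isBasis_inter_of_antitone N U hU hE
  obtain ⟨B, hB, hIB⟩ := hI.indep.exists_isBase_superset
  refine ⟨B, hB, fun j hj => ?_⟩
  have hb := hIj j hj
  have := hb.eq_of_subset_indep (hB.indep.inter_right (U j))
    (Set.inter_subset_inter_left _ hIB) Set.inter_subset_right
  rwa [this] at hb

theorem IsBasis.generalizedHammingWeight_ncard_sdiff_le [M.Finite] {I U : Set α}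
    (h : M.IsBasis I U) : M.generalizedHammingWeight (U \ I).ncard ≤ U.ncard := by
  refine generalizedHammingWeight_le h.subset_ground ?_
  rw [← h.encard_eq_eRk, Set.Finite.cast_ncard_eq
    ((M.ground_finite.subset h.subset_ground).subset Set.sdiff_subset), add_comm,
    Set.encard_sdiff_add_encard_of_subset h.subset]

theorem le_ncard_sdiff_of_eRk_add_le [M.Finite] {B U : Set α} {r : ℕ} (hB : M.Indep B)
    (hU : U ⊆ M.E) (h : M.eRk U + r ≤ U.encard) : r ≤ (U \ B).ncard := by
  have hUfin := M.ground_finite.subset hU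
  have h1 : (U ∩ B).encard ≤ M.eRk U :=
    (hB.subset Set.inter_subset_right).encard_le_eRk_of_subset Set.inter_subset_left
  have h2 : (U ∩ B).encard + r ≤ (U ∩ B).encard + (U \ B).encard := by
    rw [add_comm _ (U \ B).encard, Set.encard_sdiff_add_encard_inter]
    exact le_trans (by gcongr) h
  have h3 := (ENat.add_le_add_iff_left (Set.encard_ne_top_iff.2
    (hUfin.subset Set.inter_subset_left))).1 h2
  rw [← (hUfin.subset Set.sdiff_subset).cast_ncard_eq] at h3
  exact_mod_cast h3

end Matroid

/-! ### Extended subadditive sequences -/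

section ExtendedSubadditive

variable {d : ℕ → ℕ} {D : ℕ}

/-- The extension `q D + r ↦ q d_D + d_r` of a finite sequence `d_0, …, d_D`. -/
def quasilinearExtension (d : ℕ → ℕ) (D s : ℕ) : ℕ := s / D * d D + d (s % D)

theorem quasilinearExtension_mul_add {q r : ℕ} (hr : r < D) :
    quasilinearExtension d D (D * q + r) = q * d D + d r := by
  have hD : 0 < D := by omega
  rw [quasilinearExtension, Nat.mul_add_div hD, Nat.div_eq_of_lt hr, Nat.mul_add_mod,
    Nat.mod_eq_of_lt hr, add_zero]

theorem quasilinearExtension_mono (hD : 0 < D) (hd : ∀ i j, i ≤ j → j ≤ D → d i ≤ d j) :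
    Monotone (quasilinearExtension d D) := by
  intro a b hab
  unfold quasilinearExtension
  have ha := Nat.mod_lt a hD
  have hb := Nat.mod_lt b hD
  rcases (Nat.div_le_div_right (c := D) hab).eq_or_lt with h | h
  · rw [h]
    have : a % D ≤ b % D := by
      have := Nat.div_add_mod a D
      have := Nat.div_add_mod b D
      rw [h] at *
      omega
    exact Nat.add_le_add_left (hd _ _ this hb.le) _
  · calc a / D * d D + d (a % D) ≤ a / D * d D + d D := Nat.add_le_add_left (hd _ _ ha.le le_rfl) _
      _ = (a / D + 1) * d D := by ring
      _ ≤ b / D * d D := Nat.mul_le_mul_right _ h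
      _ ≤ _ := Nat.le_add_right _ _

/-- Only one summand has to be at most `D`, so the bound can be iterated. With `r = a % D`, plain
subadditivity handles `r + b ≤ D`, and the second family of inequalities handles the carry. -/
theorem IsExtendedSubadditiveSeq.quasilinearExtension_add_le
    (h : IsExtendedSubadditiveSeq d D) (hD : 0 < D) (h0 : d 0 = 0) (a : ℕ) {b : ℕ} (hb : b ≤ D) :
    quasilinearExtension d D (a + b) ≤ quasilinearExtension d D a + d b := by
  obtain ⟨q, r, hr, rfl⟩ : ∃ q r, r < D ∧ a = D * q + r :=
    ⟨a / D, a % D, Nat.mod_lt a hD, (Nat.div_add_mod a D).symm⟩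
  rw [quasilinearExtension_mul_add hr]
  rcases Nat.eq_zero_or_pos b with rfl | hb0
  · rw [add_zero, quasilinearExtension_mul_add hr]
    omega
  rcases Nat.eq_zero_or_pos r with rfl | hr0
  · rcases hb.eq_or_lt with rfl | hlt
    · have := quasilinearExtension_mul_add (d := d) (q := q + 1) hD
      rw [show b * q + 0 + b = b * (q + 1) + 0 by ring, this]
      exact (by ring : _ = _).le
    · rw [add_zero, quasilinearExtension_mul_add hlt]
      omega
  rcases lt_trichotomy (r + b) D with hlt | heq | hgt
  · rw [add_assoc, quasilinearExtension_mul_add hlt]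
    have := h.1 r b hr0 hb0 hlt.le
    omega
  · have := h.1 r b hr0 hb0 heq.le
    rw [heq] at this
    rw [show D * q + r + b = D * (q + 1) + 0 by rw [add_assoc, heq]; ring,
      quasilinearExtension_mul_add hD, h0, add_one_mul]
    omega
  · have := h.2 (r + b - D) b (by omega) (by omega) hb
    rw [show D + (r + b - D) - b = r by omega] at this
    rw [show D * q + r + b = D * (q + 1) + (r + b - D) by rw [mul_add]; omega,
      quasilinearExtension_mul_add (by omega), add_one_mul]
    omega

theorem IsExtendedSubadditiveSeq.quasilinearExtension_sum_le
    (h : IsExtendedSubadditiveSeq d D) (hD : 0 < D) (h0 : d 0 = 0) (a : ℕ → ℕ) (N : ℕ)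
    (ha : ∀ j < N, a j ≤ D) :
    quasilinearExtension d D (∑ j ∈ Finset.range N, a j) ≤ ∑ j ∈ Finset.range N, d (a j) := by
  induction N with
  | zero => simp [quasilinearExtension, h0]
  | succ N ih =>
    rw [Finset.sum_range_succ, Finset.sum_range_succ]
    exact (h.quasilinearExtension_add_le hD h0 _ (ha N (by omega))).trans
      (Nat.add_le_add_right (ih fun j hj => ha j (by omega)) _)

end ExtendedSubadditive

/-! ### Degrees of monomials in symbolic powers -/

section SymbolicDegrees

variable {σ : Type*} [DecidableEq σ]

/-- The degrees of the monomials that have weight at least `s` off every facet of `Δ`. -/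
def symbolicDegrees (Δ : LowerSet (Finset σ)) (s : ℕ) : Set ℕ :=
  {d | ∃ m : σ →₀ ℕ, (∀ F, Maximal (· ∈ Δ) F → s ≤ Finsupp.weight (complWeight F) m) ∧
    m.degree = d}

theorem zero_mem_symbolicDegrees (Δ : LowerSet (Finset σ)) : 0 ∈ symbolicDegrees Δ 0 :=
  ⟨0, fun _ _ => Nat.zero_le _, map_zero _⟩

theorem add_mem_symbolicDegrees {Δ : LowerSet (Finset σ)} {s t a b : ℕ}
    (ha : a ∈ symbolicDegrees Δ s) (hb : b ∈ symbolicDegrees Δ t) :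
    a + b ∈ symbolicDegrees Δ (s + t) := by
  obtain ⟨m, hm, rfl⟩ := ha
  obtain ⟨m', hm', rfl⟩ := hb
  refine ⟨m + m', fun F hF => ?_, map_add _ _ _⟩
  rw [map_add]
  exact add_le_add (hm F hF) (hm' F hF)

theorem mul_mem_symbolicDegrees {Δ : LowerSet (Finset σ)} {s a : ℕ}
    (ha : a ∈ symbolicDegrees Δ s) (q : ℕ) : q * a ∈ symbolicDegrees Δ (s * q) := by
  induction q with
  | zero => simpa using zero_mem_symbolicDegrees Δ
  | succ q ih => simpa only [add_one_mul, mul_add_one] using add_mem_symbolicDegrees ih ha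

/-- Layer-cake summation: each exponent `m e` counts the levels `j` with `j < m e`. -/
theorem weight_complWeight_eq_sum_card [Fintype σ] (F : Finset σ) (m : σ →₀ ℕ) {N : ℕ}
    (hN : ∀ e, m e ≤ N) :
    Finsupp.weight (complWeight F) m =
      ∑ j ∈ Finset.range N, ((Finset.univ.filter fun e => j < m e) \ F).card := by
  have h : ∀ j, ((Finset.univ.filter fun e => j < m e) \ F).card =
      ∑ e, (if j < m e then 1 else 0) * complWeight F e := by
    intro j
    rw [Finset.card_eq_sum_ones, ← Finset.sum_filter_add_sum_filter_not Finset.univ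
      (fun e => e ∈ (Finset.univ.filter fun e => j < m e) \ F)]
    rw [Finset.filter_mem_eq_inter, Finset.univ_inter, ← add_zero (Finset.sum _ fun _ => 1)]
    congr 1
    · refine Finset.sum_congr rfl fun e he => ?_
      simp only [Finset.mem_sdiff, Finset.mem_filter, Finset.mem_univ, true_and] at he
      simp [complWeight, he.1, he.2]
    · refine (Finset.sum_eq_zero fun e he => ?_).symm
      simp only [Finset.mem_sdiff, Finset.mem_filter, Finset.mem_univ, true_and, not_and,
        not_not] at he
      by_cases hj : j < m e
      · simp [complWeight, he hj]
      · simp [hj]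
  simp_rw [h]
  rw [Finset.sum_comm, Finsupp.weight_eq_sum]
  refine Finset.sum_congr rfl fun e _ => ?_
  rw [← Finset.sum_mul, smul_eq_mul]
  congr 1
  rw [← Finset.card_filter, show (Finset.range N).filter (· < m e) = Finset.range (m e) by
    ext j; have := hN e; simp only [Finset.mem_filter, Finset.mem_range]; omega,
    Finset.card_range]

theorem degree_eq_weight_complWeight_empty (m : σ →₀ ℕ) :
    m.degree = Finsupp.weight (complWeight ∅) m := by
  rw [Finsupp.degree_eq_weight_one]
  congr 1

end SymbolicDegrees

/-! ### Upper and lower bounds for the independence complex -/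

namespace Matroid

variable {α : Type*} {M : Matroid α}

theorem mem_independenceComplex {A : Finset M.E} :
    A ∈ M.independenceComplex ↔ M.Indep ((↑) '' (A : Set M.E)) := Iff.rfl

theorem maximal_mem_independenceComplex_iff [M.Finite] {F : Finset M.E} :
    Maximal (· ∈ M.independenceComplex) F ↔ M.IsBase ((↑) '' (F : Set M.E)) := by
  have := M.ground_finite.to_subtype
  rw [isBase_iff_maximal_indep]
  constructor
  · rintro ⟨h1, h2⟩
    refine ⟨h1, fun J hJ hFJ => ?_⟩
    have hJfin : ((↑) ⁻¹' J : Set M.E).Finite := Set.toFinite _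
    have hJim : ((↑) '' ((↑) ⁻¹' J : Set M.E) : Set α) = J := by
      rw [Subtype.image_preimage_coe]
      exact Set.inter_eq_self_of_subset_right hJ.subset_ground
    have := h2 (y := hJfin.toFinset) (by
      rwa [← hJim, ← hJfin.coe_toFinset] at hJ) (by
      intro e he
      rw [Set.Finite.mem_toFinset]
      exact hFJ ⟨e, he, rfl⟩)
    rw [← hJim]
    refine Set.image_mono fun e he => this ?_
    rwa [Set.Finite.mem_toFinset]
  · rintro ⟨h1, h2⟩
    refine ⟨h1, fun J hJ hFJ => ?_⟩
    have := h2 hJ (Set.image_mono (Finset.coe_subset.2 hFJ))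
    exact Finset.coe_subset.1 ((Set.image_subset_image_iff Subtype.val_injective).1 this)

theorem ncard_image_sdiff_image [DecidableEq M.E] (A F : Finset M.E) :
    (((↑) '' (A : Set M.E) : Set α) \ ((↑) '' (F : Set M.E))).ncard = (A \ F).card := by
  rw [← Set.image_sdiff Subtype.val_injective, Set.ncard_image_of_injective _
    Subtype.val_injective, ← Finset.coe_sdiff, Set.ncard_coe_finset]

theorem generalizedHammingWeight_mem_symbolicDegrees [M.Finite] [DecidableEq M.E] {r : ℕ}
    (h : M.eRank + r ≤ M.E.encard) :
    M.generalizedHammingWeight r ∈ symbolicDegrees M.independenceComplex r := by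
  have := M.ground_finite.fintype
  obtain ⟨U, hU, hr, hcard⟩ := exists_ncard_eq_generalizedHammingWeight h
  obtain ⟨A, rfl⟩ : ∃ A : Finset M.E, (↑) '' (A : Set M.E) = U := by
    refine ⟨(Set.toFinite ((↑) ⁻¹' U : Set M.E)).toFinset, ?_⟩
    rw [Set.Finite.coe_toFinset, Subtype.image_preimage_coe]
    exact Set.inter_eq_self_of_subset_right hU
  have hw : ∀ F : Finset M.E, Finsupp.weight (complWeight F)
      (Finsupp.indicator A fun _ _ => (1 : ℕ)) = (A \ F).card := by
    intro F
    have h1 : ∀ e : M.E, (Finsupp.indicator A fun _ _ => (1 : ℕ)) e = if e ∈ A then 1 else 0 :=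
      fun e => by simp [Finsupp.indicator_apply]
    rw [weight_complWeight_eq_sum_card (N := 1) F _ (fun e => by rw [h1]; split_ifs <;> simp)]
    rw [Finset.sum_range_one]
    congr 2
    ext e
    rw [Finset.mem_filter, h1]
    split_ifs with he <;> simp [he]
  refine ⟨Finsupp.indicator A fun _ _ => 1, fun F hF => ?_, ?_⟩
  · rw [hw, ← ncard_image_sdiff_image]
    exact le_ncard_sdiff_of_eRk_add_le (mem_independenceComplex.1 hF.1) hU hr
  · rw [degree_eq_weight_complWeight_empty, hw, ← hcard, Finset.sdiff_empty,
      Set.ncard_image_of_injective _ Subtype.val_injective, Set.ncard_coe_finset]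

theorem mul_add_mem_symbolicDegrees [M.Finite] [DecidableEq M.E] {D q r : ℕ}
    (hD : M.eRank + D ≤ M.E.encard) (hr : r ≤ D) :
    q * M.generalizedHammingWeight D + M.generalizedHammingWeight r ∈
      symbolicDegrees M.independenceComplex (D * q + r) :=
  add_mem_symbolicDegrees
    (mul_mem_symbolicDegrees (generalizedHammingWeight_mem_symbolicDegrees hD) q)
    (generalizedHammingWeight_mem_symbolicDegrees (le_trans (by gcongr) hD))

theorem quasilinearExtension_le_of_mem_symbolicDegrees [M.Finite] [DecidableEq M.E] {D s d : ℕ}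
    (hD : M.eRank + D = M.E.encard) (hD0 : 0 < D)
    (hsub : IsExtendedSubadditiveSeq M.generalizedHammingWeight D)
    (hd : d ∈ symbolicDegrees M.independenceComplex s) :
    quasilinearExtension M.generalizedHammingWeight D s ≤ d := by
  have := M.ground_finite.fintype
  obtain ⟨m, hm, rfl⟩ := hd
  set A : ℕ → Finset M.E := fun j => Finset.univ.filter fun e => j < m e with hA
  have hN : ∀ e, m e ≤ m.degree := fun e => Finsupp.le_degree e m
  obtain ⟨B, hB, hBj⟩ := M.exists_isBase_inter_isBasis_of_antitone m.degree
    (fun j => (↑) '' (A j : Set M.E)) (fun i j hij => Set.image_mono fun e he => by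
      simp only [hA, Finset.coe_filter, Finset.mem_univ, true_and, Set.mem_ofPred_eq] at he ⊢
      omega) (by rintro _ ⟨e, -, rfl⟩; exact e.2)
  obtain ⟨F, rfl⟩ : ∃ F : Finset M.E, (↑) '' (F : Set M.E) = B := by
    refine ⟨(Set.toFinite ((↑) ⁻¹' B : Set M.E)).toFinset, ?_⟩
    rw [Set.Finite.coe_toFinset, Subtype.image_preimage_coe]
    exact Set.inter_eq_self_of_subset_right hB.subset_ground
  have hs := hm F (maximal_mem_independenceComplex_iff.2 hB)
  rw [weight_complWeight_eq_sum_card F m hN] at hs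
  have hmono := quasilinearExtension_mono hD0 fun i j hij hj =>
    generalizedHammingWeight_mono hij (le_trans (by gcongr) hD.le)
  -- The complement of a base has exactly `D` elements; this keeps the indices within the range of
  -- the sequence.
  have hle : ∀ j, (A j \ F).card ≤ D := by
    intro j
    rw [← ncard_image_sdiff_image]
    refine (Set.ncard_le_ncard (t := M.E \ (↑) '' (F : Set M.E))
      (Set.sdiff_subset_sdiff_left ?_) (M.ground_finite.subset Set.sdiff_subset)).trans ?_
    · rintro _ ⟨e, -, rfl⟩
      exact e.2
    · have h1 := Set.encard_sdiff_add_encard_of_subset hB.subset_ground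
      have h2 : M.eRank ≠ ⊤ := by
        rw [← hB.encard_eq_eRank]
        exact Set.encard_ne_top_iff.2 (M.ground_finite.subset hB.subset_ground)
      rw [hB.encard_eq_eRank, ← hD, add_comm] at h1
      have h3 := (ENat.add_le_add_iff_left h2).1 h1.le
      exact ENat.toNat_le_of_le_natCast h3
  refine (hmono hs).trans ((hsub.quasilinearExtension_sum_le hD0 rfl _ _ fun j _ => hle j).trans ?_)
  refine le_trans ?_ ((degree_eq_weight_complWeight_empty m).trans
    (weight_complWeight_eq_sum_card ∅ m hN)).ge
  refine Finset.sum_le_sum fun j hj => ?_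
  -- As `F` meets `A j` in a basis, `|A j \ F|` is the nullity of `A j`.
  have := (hBj j (Finset.mem_range.1 hj)).generalizedHammingWeight_ncard_sdiff_le
  rwa [Set.inter_comm, Set.sdiff_self_inter, ncard_image_sdiff_image,
    Set.ncard_image_of_injective _ Subtype.val_injective, Set.ncard_coe_finset,
    ← congrArg Finset.card (A j).sdiff_empty] at this

end Matroid

/-! ### The limit and the equivalence -/

/-- With `r = s % D` the error is `(D d_r - r d_D) / (D s)`. Both terms of the numerator lie in `[0,
D d_D]`, so it is at most `d_D / s` in absolute value. -/
theorem tendsto_quasilinearExtension_div {d : ℕ → ℕ} {D : ℕ} (hD : 0 < D)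
    (hd : ∀ i < D, d i ≤ d D) :
    Filter.Tendsto (fun s : ℕ => (quasilinearExtension d D s : ℝ) / s) Filter.atTop
      (nhds ((d D : ℝ) / D)) := by
  rw [tendsto_iff_norm_sub_tendsto_zero]
  refine squeeze_zero' (Filter.Eventually.of_forall fun _ => norm_nonneg _) ?_
    (tendsto_const_div_atTop_nhds_zero_nat (d D : ℝ))
  filter_upwards [Filter.eventually_gt_atTop 0] with s hs
  have hD' : (0 : ℝ) < D := by exact_mod_cast hD
  have hs' : (0 : ℝ) < s := by exact_mod_cast hs
  have hr := Nat.mod_lt s hD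
  have hs2 : (s : ℝ) = D * (s / D : ℕ) + (s % D : ℕ) := by exact_mod_cast (Nat.div_add_mod s D).symm
  have hdr : (d (s % D) : ℝ) ≤ d D := by exact_mod_cast hd _ hr
  have hr' : ((s % D : ℕ) : ℝ) ≤ D := by exact_mod_cast hr.le
  have h1 : (quasilinearExtension d D s : ℝ) / s - d D / D =
      (D * d (s % D) - (s % D : ℕ) * d D) / (D * s) := by
    rw [quasilinearExtension, div_sub_div _ _ hs'.ne' hD'.ne', mul_comm (s : ℝ) D]
    congr 1
    simp only [Nat.cast_add, Nat.cast_mul]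
    linear_combination (-(d D : ℝ)) * hs2
  rw [h1, Real.norm_eq_abs, abs_div, abs_of_pos (mul_pos hD' hs'),
    div_le_div_iff₀ (mul_pos hD' hs') hs', ← mul_assoc, mul_comm (d D : ℝ) D]
  refine mul_le_mul_of_nonneg_right (abs_sub_le_of_nonneg_of_le (by positivity) ?_ (by positivity)
    ?_) hs'.le
  · exact mul_le_mul_of_nonneg_left hdr hD'.le
  · exact mul_le_mul_of_nonneg_right hr' (Nat.cast_nonneg _)

/-- The existence of the limit defining the Waldschmidt constant is part of the conclusion. -/
theorem mainTheorem5 {α : Type*} (M : Matroid α) [M.Finite] (L : Type*) [Field L] (n k : ℕ)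
    (hn : M.E.ncard = n) (hk : M.eRank = (k : ℕ∞)) (hkn : k < n) :
    ((∀ s q r : ℕ, s = (n - k) * q + r → r < n - k →
        initialDegree (symbolicPower (stanleyReisnerIdeal L M.independenceComplex) s) =
          q * M.generalizedHammingWeight (n - k) + M.generalizedHammingWeight r) ↔
      IsExtendedSubadditiveSeq M.generalizedHammingWeight (n - k)) ∧
    (IsExtendedSubadditiveSeq M.generalizedHammingWeight (n - k) →
      Filter.Tendsto
        (fun s : ℕ =>
          (initialDegree (symbolicPower (stanleyReisnerIdeal L M.independenceComplex) s) : ℝ) /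
            (s : ℝ))
        Filter.atTop
        (nhds (waldschmidtConstant (stanleyReisnerIdeal L M.independenceComplex))) ∧
      waldschmidtConstant (stanleyReisnerIdeal L M.independenceComplex) =
        (M.generalizedHammingWeight (n - k) : ℝ) / ((n : ℝ) - (k : ℝ))) := by
  classical
  have := M.ground_finite.to_subtype
  obtain ⟨D, rfl⟩ := Nat.exists_eq_add_of_lt hkn
  rw [show k + D + 1 - k = D + 1 by omega,
    show ((k + D + 1 : ℕ) : ℝ) - k = (D + 1 : ℕ) by push_cast; ring]
  have hD : M.eRank + (D + 1 : ℕ) = M.E.encard := by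
    rw [hk, ← M.ground_finite.cast_ncard_eq, hn, add_assoc]
    norm_cast
  generalize hDe : D + 1 = D' at hD ⊢
  have hD0 : 0 < D' := by omega
  set d := M.generalizedHammingWeight with hd
  have hinit : ∀ s, initialDegree (symbolicPower (stanleyReisnerIdeal L M.independenceComplex) s) =
      sInf (symbolicDegrees M.independenceComplex s) := fun s =>
    initialDegree_symbolicPower_stanleyReisnerIdeal s
  have key : IsExtendedSubadditiveSeq d D' → ∀ s,
      initialDegree (symbolicPower (stanleyReisnerIdeal L M.independenceComplex) s) =
        quasilinearExtension d D' s := by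
    intro h s
    rw [hinit]
    have hmem : quasilinearExtension d D' s ∈ symbolicDegrees M.independenceComplex s := by
      have := Matroid.mul_add_mem_symbolicDegrees (q := s / D') hD.le (Nat.mod_lt s hD0).le
      rwa [Nat.div_add_mod] at this
    exact le_antisymm (Nat.sInf_le hmem) (le_csInf ⟨_, hmem⟩ fun e he =>
      Matroid.quasilinearExtension_le_of_mem_symbolicDegrees hD hD0 h he)
  refine ⟨⟨fun h => ?_, fun h s q r hs hr => ?_⟩, fun h => ?_⟩
  · have hadd : ∀ i j, i ≤ D' → j ≤ D' →
        initialDegree (symbolicPower (stanleyReisnerIdeal L M.independenceComplex) (i + j)) ≤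
          d i + d j := fun i j hi hj => by
      rw [hinit]
      exact Nat.sInf_le (add_mem_symbolicDegrees
        (Matroid.generalizedHammingWeight_mem_symbolicDegrees (le_trans (by gcongr) hD.le))
        (Matroid.generalizedHammingWeight_mem_symbolicDegrees (le_trans (by gcongr) hD.le)))
    refine ⟨fun i j hi hj hij => ?_, fun r t hr hrt ht => ?_⟩
    · refine le_trans ?_ (hadd i j (by omega) (by omega))
      -- `D'` is not an admissible remainder, so `i + j = D'` is read as `q = 1`, `r = 0`, using `d
      -- 0 = 0`.
      rcases hij.eq_or_lt with heq | hlt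
      · rw [h (i + j) 1 0 (by omega) hD0, heq]
        omega
      · rw [h (i + j) 0 (i + j) (by omega) hlt]
        omega
    -- The two indices sum to `D' + r`, whose quotient is `1` and remainder `r < t ≤ D'`.
    · refine le_trans ?_ (hadd t (D' + r - t) ht (by omega))
      rw [h _ 1 r (by omega) (by omega)]
      omega
  · rw [key h, hs, quasilinearExtension_mul_add hr]
  · have hlim := tendsto_quasilinearExtension_div hD0 fun i hi =>
      Matroid.generalizedHammingWeight_mono (M := M) hi.le hD.le
    replace hlim := hlim.congr fun s => by rw [← key h]
    -- `limUnder` is meaningful only because convergence has been proved; uniqueness of limits then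
    -- identifies it.
    have hw : waldschmidtConstant (stanleyReisnerIdeal L M.independenceComplex) =
        (d D' : ℝ) / D' := hlim.limUnder_eq
    exact ⟨hw ▸ hlim, hw⟩
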